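/- There are absolute constants $C, c, C', c'$ such that the following holds. Let $d, k \ge 0$ be integers, let $\Delta, \varepsilon > 0$ be real numbers, and put $D = d\Delta/\varepsilon$, $f = kD + k^{2/3}D^4$ and $g = kD^4$. Equip $[0,\Delta]^d$ with the $\ell_1$ metric, and for Borel probability distributions $p, q$ on it let $$\mathrm{EMD}(p,q) = \inf_{\gamma} \int \|x-y\|_1 \, d\gamma(x,y),$$ the infimum being over all couplings $\gamma$ of $p$ and $q$ (for finitely supported $p, q$ this is the minimum cost of a flow with supply $p$ and demand $q$). Then there is a randomized tester, depending only on $d, \Delta, \varepsilon, k$, that draws a fixed number $N$ of independent samples in total, half of them from $p$ and half from $q$, and then accepts or rejects, such that for all Borel probability distributions $p, q$ on $[0,\Delta]^d$ whose combined support $\mathrm{supp}(p) \cup \mathrm{supp}(q)$ can be partitioned into $k$ (possibly empty) clusters of diameter at most $\varepsilon/4$ (the clusters and their centers are not given to the tester): 1. if $p = q$, it accepts with probability at least $2/3$; 2. if $\mathrm{EMD}(p,q) > \varepsilon$, it rejects with probability at least $2/3$. Its number of samples satisfies $$N \le C f \log^{c}(2+f) \quad\text{and}\quad N \le C' g \log^{c'}(2+g),$$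 that is, $N = \tilde O\left(kd\Delta/\varepsilon + k^{2/3}(d\Delta/\varepsilon)^4\right)$ and $N = \tilde O\left(k(d\Delta/\varepsilon)^4\right)$. Moreover, whenever $\varepsilon \le d\Delta$, the first bound is at most the second: $C f \log^{c}(2+f) \le C' g \log^{c'}(2+g)$. -/

import Mathlib

open MeasureTheory ProbabilityTheory
open scoped ENNReal

noncomputable section

namespace EMDTesting

/-- `ℝ^d` with the `ℓ₁` metric. -/
abbrev L1Space (d : ℕ) : Type := PiLp 1 (fun _ : Fin d => ℝ)

/-- The cube `[0, Δ]^d`. -/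
def cube (d : ℕ) (Δ : ℝ) : Set (L1Space d) :=
  {x | ∀ i, 0 ≤ x i ∧ x i ≤ Δ}

/-- The Earth Mover's Distance: the infimum of the transport cost over all couplings of `p`
and `q`. For finitely supported `p`, `q` a coupling is a satisfying flow of the supply-demand
network, and the integral is the cost of the flow. -/
def EMD {X : Type*} [PseudoEMetricSpace X] [MeasurableSpace X] (p q : Measure X) : ℝ≥0∞ :=
  ⨅ γ : {γ : Measure (X × X) // γ.fst = p ∧ γ.snd = q}, ∫⁻ z, edist z.1 z.2 ∂γ.1

/-- The set `S` can be partitioned into `k` (possibly empty) clusters of diameter at most `b`. -/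
def Clusterable {X : Type*} [PseudoMetricSpace X] (S : Set X) (k : ℕ) (b : ℝ) : Prop :=
  ∃ C : Fin k → Set X, (⋃ i, C i) = S ∧ Pairwise (Function.onFun Disjoint C) ∧
    ∀ i, ∀ x ∈ C i, ∀ y ∈ C i, dist x y ≤ b

/-- A randomized algorithm that reads `n` samples from each of two distributions and then
answers `true` (accept) or `false` (reject): a Markov kernel from the samples to `Bool`. -/
structure SampleTester (X : Type*) [MeasurableSpace X] where
  /-- number of samples drawn from each of the two distributions -/
  n : ℕ
  /-- the law of the answer, given the samples -/
  rule : Kernel ((Fin n → X) × (Fin n → X)) Bool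
  /-- the answer is always given -/
  markov : IsMarkovKernel rule

/-- Total number of samples that the tester draws. -/
def SampleTester.samples {X : Type*} [MeasurableSpace X] (T : SampleTester X) : ℕ :=
  2 * T.n

/-- The law of the answer when all samples are independent, those of the first kind with law `p`
and those of the second kind with law `q`. -/
def SampleTester.answerLaw {X : Type*} [MeasurableSpace X] (T : SampleTester X)
    (p q : Measure X) : Measure Bool :=
  ((Measure.pi fun _ : Fin T.n => p).prod (Measure.pi fun _ : Fin T.n => q)).bind T.rule

/-- `T` is an EMD-closeness tester with parameter `ε` for the pairs of distributions in `A`. -/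
def SampleTester.IsEMDClosenessTester {X : Type*} [PseudoEMetricSpace X] [MeasurableSpace X]
    (T : SampleTester X) (ε : ℝ) (A : Set (Measure X × Measure X)) : Prop :=
  ∀ p q : Measure X, (p, q) ∈ A →
    (p = q → 2 / 3 ≤ T.answerLaw p q {true}) ∧
    (ENNReal.ofReal ε < EMD p q → 2 / 3 ≤ T.answerLaw p q {false})

/-- Pairs of Borel probability distributions on `[0, Δ]^d` whose combined support can be
partitioned into `k` clusters of diameter at most `b`. -/
def clusterablePairs (d : ℕ) (Δ : ℝ) (k : ℕ) (b : ℝ) :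
    Set (Measure (L1Space d) × Measure (L1Space d)) :=
  {pq | IsProbabilityMeasure pq.1 ∧ IsProbabilityMeasure pq.2 ∧
    pq.1 (cube d Δ)ᶜ = 0 ∧ pq.2 (cube d Δ)ᶜ = 0 ∧
    Clusterable (pq.1.support ∪ pq.2.support) k b}

/-- The bound `C · f · log^c (2 + f)`; a quantity is `Õ(f)` if it is at most this for some
constants `C` and `c`. -/
def softBound (C : ℝ) (c : ℕ) (f : ℝ) : ℝ :=
  C * f * Real.log (2 + f) ^ c

end EMDTesting

end

/-
Draw `n` pairs of points and cover the space by the balls of radius `ε / 4` around the first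
components. A cluster of `p`-mass `a` stays uncovered with probability at most `(1 - a) ^ n`, so it
contributes at most `a * (1 - a) ^ n ≤ 1 / n` to the expected uncovered mass, `k / n` in total. On
a set of diameter `M`, moving mass inside a cell costs at most `ε / 2` and everything else costs at
most `M`; hence `EMD p q > ε` together with uncovered mass at most `ε / (4 * M)` makes the induced
distributions on the `n + 1` cells `ε / (2 * M)`-far in `ℓ₁`.

Closeness on the cells is tested by flattening: the atom `i` is weighted by `1 / (1 + hits of i)` in
a second block, which brings the expected squared `ℓ₂` norm down to `O(1 / n)`, while the
Cauchy-Schwarz inequality keeps the weighted squared `ℓ₂` distance at least `ℓ₁ ^ 2 / (4 * n)`. The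
weighted inner product of the signed counts in two further blocks estimates this distance without
bias, and Chebyshev's inequality separates the two cases once `n` is at least a constant times
`(M / ε) ^ 4`. Only distances inside the supporting set enter, so the `ℓ₁` cube may be replaced by
any set of diameter `M` in a separable metric space.
-/

noncomputable section

namespace EMDTesting

section Moments

variable {Ω : Type*} [MeasurableSpace Ω] {μ : Measure Ω}

lemma integral_sub_const_sq [IsProbabilityMeasure μ] {Y : Ω → ℝ} (hY : MemLp Y 2 μ) (c : ℝ) :
    ∫ ω, (Y ω - c) ^ 2 ∂μ = Var[Y; μ] + (∫ ω, Y ω ∂μ - c) ^ 2 := by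
  have hmean : ∫ ω, (Y ω - c) ∂μ = ∫ ω, Y ω ∂μ - c := by
    rw [integral_sub (hY.integrable one_le_two) (integrable_const c)]
    simp
  have hvar := variance_eq_sub (hY.sub (memLp_const c))
  simp only [Pi.sub_apply, Pi.pow_apply, hmean] at hvar
  rw [← variance_sub_const hY.aestronglyMeasurable c]
  exact (sub_eq_iff_eq_add.1 hvar.symm)

lemma measureReal_le_abs_sub_le [IsFiniteMeasure μ] {Y : Ω → ℝ} {a t : ℝ} (ht : 0 < t)
    (hY : Integrable (fun ω => (Y ω - a) ^ 2) μ) :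
    μ.real {ω | t ≤ |Y ω - a|} ≤ (∫ ω, (Y ω - a) ^ 2 ∂μ) / t ^ 2 := by
  have hset : {ω | t ≤ |Y ω - a|} = {ω | t ^ 2 ≤ (Y ω - a) ^ 2} := by
    ext ω
    rw [Set.mem_ofPred_eq, Set.mem_ofPred_eq, sq_le_sq, abs_of_pos ht]
  rw [le_div_iff₀' (by positivity), hset]
  exact mul_meas_ge_le_integral_of_nonneg (.of_forall fun ω => sq_nonneg _) hY (t ^ 2)

lemma integral_sum_pi_sub_sq_le {κ : Type*} [Fintype κ] [IsProbabilityMeasure μ] {h : Ω → ℝ}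
    (hh : MemLp h 2 μ) (c : ℝ) :
    ∫ ω, (∑ s, h (ω s) - c) ^ 2 ∂(Measure.pi fun _ : κ => μ) ≤
      Fintype.card κ * ∫ z, h z ^ 2 ∂μ + (Fintype.card κ * ∫ z, h z ∂μ - c) ^ 2 := by
  have hcoord (s : κ) : MemLp (fun ω : κ → Ω => h (ω s)) 2 (Measure.pi fun _ : κ => μ) :=
    hh.comp_measurePreserving (measurePreserving_eval (fun _ : κ => μ) s)
  have hmean : ∫ ω, ∑ s, h (ω s) ∂(Measure.pi fun _ : κ => μ) =
      Fintype.card κ * ∫ z, h z ∂μ := by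
    rw [integral_finsetSum _ fun s _ => (hcoord s).integrable one_le_two]
    simp [integral_comp_eval (μ := fun _ : κ => μ) hh.aestronglyMeasurable]
  have hvar : Var[fun ω => ∑ s, h (ω s); Measure.pi fun _ : κ => μ] =
      Fintype.card κ * Var[h; μ] := by
    have := variance_sum_pi (μ := fun _ : κ => μ) (X := fun _ => h) fun _ => hh
    simpa [Finset.sum_fn] using this
  rw [integral_sub_const_sq (memLp_finsetSum _ fun s _ => hcoord s) c, hmean, hvar]
  gcongr
  exact variance_le_expectation_sq hh.aestronglyMeasurable

lemma measureReal_prod_le_add {Ω' : Type*} [MeasurableSpace Ω'] {ν : Measure Ω'}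
    [IsProbabilityMeasure μ] [IsProbabilityMeasure ν] {s : Set (Ω × Ω')} (hs : MeasurableSet s)
    {t : Set Ω} {a b : ℝ} (hb : 0 ≤ b) (ht : μ.real t ≤ a)
    (hsb : ∀ x ∉ t, ν.real (Prod.mk x ⁻¹' s) ≤ b) :
    (μ.prod ν).real s ≤ a + b := by
  have ha : 0 ≤ a := measureReal_nonneg.trans ht
  have hmem : MeasurableSet (toMeasurable μ t) := measurableSet_toMeasurable _ _
  refine ENNReal.toReal_le_of_le_ofReal (by positivity) ?_
  rw [Measure.prod_apply hs, ← lintegral_add_compl _ hmem, ENNReal.ofReal_add ha hb]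
  refine add_le_add ?_ ?_
  · calc ∫⁻ x in toMeasurable μ t, ν (Prod.mk x ⁻¹' s) ∂μ
        ≤ ∫⁻ _ in toMeasurable μ t, 1 ∂μ := lintegral_mono fun x => prob_le_one
      _ = μ t := by simp
      _ ≤ ENNReal.ofReal a := (ENNReal.le_ofReal_iff_toReal_le (measure_ne_top _ _) ha).2 ht
  · calc ∫⁻ x in (toMeasurable μ t)ᶜ, ν (Prod.mk x ⁻¹' s) ∂μ
        ≤ ∫⁻ _ in (toMeasurable μ t)ᶜ, ENNReal.ofReal b ∂μ := by
          refine setLIntegral_mono' hmem.compl fun x hx => ?_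
          exact (ENNReal.le_ofReal_iff_toReal_le (measure_ne_top _ _) hb).2
            (hsb x fun hxt => hx (subset_toMeasurable _ _ hxt))
      _ ≤ ENNReal.ofReal b := by
          rw [setLIntegral_const]
          exact mul_le_of_le_one_right' prob_le_one

end Moments

/-- The joint law of `n` independent pairs of one sample from `p` and one sample from `q`. -/
abbrev pairLaw {X : Type*} [MeasurableSpace X] (p q : Measure X) (n : ℕ) :
    Measure (Fin n → X × X) :=
  Measure.pi fun _ => p.prod q

section Counts

variable {ι : Type*} [DecidableEq ι] {n : ℕ}

/-- The signed count of `i` in a paired sample: its occurrences as a first component minus its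
occurrences as a second component. -/
def countDiff (ω : Fin n → ι × ι) (i : ι) : ℝ :=
  ∑ s, ((if (ω s).1 = i then 1 else 0) - (if (ω s).2 = i then 1 else 0))

/-- The number of occurrences of `i` among all `2 * n` entries of a paired sample. -/
def hitCount (ω : Fin n → ι × ι) (i : ι) : ℝ :=
  ∑ s, ((if (ω s).1 = i then 1 else 0) + (if (ω s).2 = i then 1 else 0))

/-- The flattening weight of `i`. Splitting the atom `i` into `1 + hitCount ω i` equal parts
multiplies its contribution to the squared `ℓ₂` norm by this factor. -/
def weight (ω : Fin n → ι × ι) (i : ι) : ℝ := (1 + hitCount ω i)⁻¹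

lemma hitCount_nonneg (ω : Fin n → ι × ι) (i : ι) : 0 ≤ hitCount ω i :=
  Finset.sum_nonneg fun s _ => by positivity

lemma weight_pos (ω : Fin n → ι × ι) (i : ι) : 0 < weight ω i :=
  inv_pos.2 (by linarith [hitCount_nonneg ω i])

lemma weight_le_one (ω : Fin n → ι × ι) (i : ι) : weight ω i ≤ 1 :=
  inv_le_one_of_one_le₀ (by linarith [hitCount_nonneg ω i])

variable [Fintype ι]

lemma sum_hitCount (ω : Fin n → ι × ι) : ∑ i, hitCount ω i = 2 * n := by
  simp only [hitCount]
  rw [Finset.sum_comm]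
  simp [Finset.sum_add_distrib, two_mul]

lemma sum_mul_countDiff (c : ι → ℝ) (ω : Fin n → ι × ι) :
    ∑ i, c i * countDiff ω i = ∑ s, (c (ω s).1 - c (ω s).2) := by
  simp only [countDiff, Finset.mul_sum]
  rw [Finset.sum_comm]
  simp [mul_sub, Finset.sum_sub_distrib]

lemma sq_sum_abs_le_sum_weight_mul_sq (ω : Fin n → ι × ι) (v : ι → ℝ) :
    (∑ i, |v i|) ^ 2 ≤ (∑ i, weight ω i * v i ^ 2) * (Fintype.card ι + 2 * n) := by
  have hpos (i : ι) : 0 < 1 + hitCount ω i := by linarith [hitCount_nonneg ω i]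
  have hcard : ∑ i, (1 + hitCount ω i) = Fintype.card ι + 2 * n := by
    rw [Finset.sum_add_distrib, sum_hitCount]
    simp
  rw [← hcard]
  refine Finset.sum_sq_le_sum_mul_sum_of_sq_le_mul _
    (fun i _ => mul_nonneg (weight_pos ω i).le (sq_nonneg _)) (fun i _ => (hpos i).le)
    fun i _ => le_of_eq ?_
  rw [sq_abs, weight]
  field_simp [(hpos i).ne']

/-- The closeness statistic of two paired samples: the weighted inner product of their signed
counts, an unbiased estimator of `n ^ 2 * weightedSqDist w p q`. -/
def stat (w : ι → ℝ) (ω ω' : Fin n → ι × ι) : ℝ :=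
  ∑ i, w i * countDiff ω i * countDiff ω' i

/-- The rejection region of the closeness tester for `ℓ₁` distance `δ` on the finite domain `ι`.
The first sample determines the weights, the other two the statistic. -/
def rejectSet (ι : Type*) [Fintype ι] [DecidableEq ι] (n : ℕ) (δ : ℝ) :
    Set ((Fin n → ι × ι) × (Fin n → ι × ι) × (Fin n → ι × ι)) :=
  {ω | n * δ ^ 2 / 8 < stat (weight ω.1) ω.2.1 ω.2.2}

end Counts

section FiniteDomain

variable {ι : Type*} [Fintype ι] [MeasurableSpace ι]

/-- The squared `ℓ₂` norm of `p + q` on the flattened domain. -/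
def weightedCollision (w : ι → ℝ) (p q : Measure ι) : ℝ :=
  ∑ i, (w i * (p.real {i} + q.real {i})) ^ 2

/-- The squared `ℓ₂` distance of `p` and `q` with weights `w`. -/
def weightedSqDist (w : ι → ℝ) (p q : Measure ι) : ℝ :=
  ∑ i, w i * (p.real {i} - q.real {i}) ^ 2

lemma weightedCollision_nonneg (w : ι → ℝ) (p q : Measure ι) : 0 ≤ weightedCollision w p q :=
  Finset.sum_nonneg fun _ _ => sq_nonneg _

lemma weightedSqDist_nonneg {w : ι → ℝ} (hw : ∀ i, 0 ≤ w i) (p q : Measure ι) :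
    0 ≤ weightedSqDist w p q :=
  Finset.sum_nonneg fun i _ => mul_nonneg (hw i) (sq_nonneg _)

lemma mul_measureReal_add_le_sqrt_weightedCollision (w : ι → ℝ) (p q : Measure ι) (i : ι) :
    w i * (p.real {i} + q.real {i}) ≤ √(weightedCollision w p q) :=
  Real.le_sqrt_of_sq_le <| Finset.single_le_sum
    (f := fun i => (w i * (p.real {i} + q.real {i})) ^ 2) (fun _ _ => sq_nonneg _)
    (Finset.mem_univ i)

lemma sq_le_mul_weightedSqDist_weight [DecidableEq ι] {n : ℕ} (hn : 0 < n) {p q : Measure ι}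
    (hcard : Fintype.card ι ≤ n + 1) {δ : ℝ} (hδ : 0 ≤ δ)
    (hfar : δ ≤ ∑ i, |p.real {i} - q.real {i}|) (ω : Fin n → ι × ι) :
    δ ^ 2 ≤ 4 * n * weightedSqDist (weight ω) p q := by
  have hsize : (Fintype.card ι + 2 * n : ℝ) ≤ 4 * n := by
    exact_mod_cast (by omega : Fintype.card ι + 2 * n ≤ 4 * n)
  calc δ ^ 2 ≤ (∑ i, |p.real {i} - q.real {i}|) ^ 2 := by gcongr
    _ ≤ weightedSqDist (weight ω) p q * (Fintype.card ι + 2 * n) :=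
        sq_sum_abs_le_sum_weight_mul_sq ω _
    _ ≤ weightedSqDist (weight ω) p q * (4 * n) := by
        gcongr
        exact weightedSqDist_nonneg (fun i => (weight_pos ω i).le) p q
    _ = 4 * n * weightedSqDist (weight ω) p q := mul_comm _ _

variable [MeasurableSingletonClass ι] (p q : Measure ι) [IsProbabilityMeasure p]
  [IsProbabilityMeasure q]

lemma integral_fst_add_snd (f g : ι → ℝ) :
    ∫ z, (f z.1 + g z.2) ∂(p.prod q) = ∑ i, (f i * p.real {i} + g i * q.real {i}) := by
  rw [integral_add .of_finite .of_finite, integral_fun_fst f, integral_fun_snd g,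
    integral_fintype .of_finite, integral_fintype .of_finite]
  simp [Finset.sum_add_distrib, mul_comm]

lemma integral_prod_sub_sq_le (c : ι → ℝ) :
    ∫ z, (c z.1 - c z.2) ^ 2 ∂(p.prod q) ≤ 2 * ∑ i, c i ^ 2 * (p.real {i} + q.real {i}) := by
  calc ∫ z, (c z.1 - c z.2) ^ 2 ∂(p.prod q)
      ≤ ∫ z, 2 * (c z.1 ^ 2 + c z.2 ^ 2) ∂(p.prod q) :=
        integral_mono .of_finite .of_finite fun z => by
          linarith [sq_nonneg (c z.1 + c z.2)]
    _ = 2 * ∑ i, c i ^ 2 * (p.real {i} + q.real {i}) := by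
        rw [integral_const_mul, integral_fst_add_snd p q (fun i => c i ^ 2) fun i => c i ^ 2]
        simp only [mul_add]

variable [DecidableEq ι] (n : ℕ)

lemma integral_sum_mul_countDiff_sub_sq_le (c : ι → ℝ) (a : ℝ) :
    ∫ ω, (∑ i, c i * countDiff ω i - a) ^ 2 ∂pairLaw p q n ≤
      2 * n * ∑ i, c i ^ 2 * (p.real {i} + q.real {i}) +
        (n * ∑ i, c i * (p.real {i} - q.real {i}) - a) ^ 2 := by
  have hmean : ∫ z, (c z.1 - c z.2) ∂(p.prod q) = ∑ i, c i * (p.real {i} - q.real {i}) := by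
    simpa [sub_eq_add_neg, mul_add] using integral_fst_add_snd p q c fun i => -c i
  have h := integral_sum_pi_sub_sq_le (κ := Fin n) (μ := p.prod q)
    (h := fun z => c z.1 - c z.2) .of_discrete a
  rw [Fintype.card_fin, hmean] at h
  simp only [sum_mul_countDiff]
  refine h.trans ?_
  rw [mul_comm 2 (n : ℝ), mul_assoc]
  gcongr
  exact integral_prod_sub_sq_le p q c

omit [Fintype ι] in
lemma integral_countDiff_sq_le [Finite ι] (i : ι) :
    ∫ ω, countDiff ω i ^ 2 ∂pairLaw p q n ≤
      2 * n * (p.real {i} + q.real {i}) + (n * (p.real {i} - q.real {i})) ^ 2 := by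
  have := Fintype.ofFinite ι
  simpa [Pi.single_apply] using
    integral_sum_mul_countDiff_sub_sq_le p q n (Pi.single i 1) 0

lemma integral_stat_sub_sq_le_sum (w : ι → ℝ) :
    ∫ ω, (stat w ω.1 ω.2 - n ^ 2 * weightedSqDist w p q) ^ 2
        ∂(pairLaw p q n).prod (pairLaw p q n) ≤
      4 * n ^ 2 * weightedCollision w p q +
        4 * n ^ 3 * ∑ i, (w i * (p.real {i} - q.real {i})) ^ 2 * (p.real {i} + q.real {i}) := by
  set r : ι → ℝ := fun i => p.real {i} + q.real {i} with hr
  set m : ι → ℝ := fun i => p.real {i} - q.real {i} with hm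
  set S := weightedSqDist w p q with hS
  have hSm : S = ∑ i, w i * m i * m i := by simp only [hS, hm, weightedSqDist, sq, mul_assoc]
  have hcond (ω : Fin n → ι × ι) : ∫ ω', (stat w ω ω' - n ^ 2 * S) ^ 2 ∂pairLaw p q n ≤
      2 * n * ∑ i, w i ^ 2 * r i * countDiff ω i ^ 2 +
        n ^ 2 * (∑ i, w i * m i * countDiff ω i - n * S) ^ 2 := by
    refine (integral_sum_mul_countDiff_sub_sq_le p q n (fun i => w i * countDiff ω i)
      (n ^ 2 * S)).trans_eq ?_
    simp only [mul_pow, mul_right_comm (w _) (countDiff ω _),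
      mul_right_comm (w _ ^ 2) (countDiff ω _ ^ 2)]
    ring
  have hfirst : ∫ ω, ∑ i, w i ^ 2 * r i * countDiff ω i ^ 2 ∂pairLaw p q n ≤
      2 * n * weightedCollision w p q + n ^ 2 * ∑ i, (w i * m i) ^ 2 * r i := by
    rw [integral_finsetSum _ fun _ _ => .of_finite, weightedCollision, Finset.mul_sum,
      Finset.mul_sum, ← Finset.sum_add_distrib]
    refine Finset.sum_le_sum fun i _ => ?_
    rw [integral_const_mul]
    refine (mul_le_mul_of_nonneg_left (integral_countDiff_sq_le p q n i)
      (by positivity)).trans_eq ?_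
    ring
  have hsecond : ∫ ω, (∑ i, w i * m i * countDiff ω i - n * S) ^ 2 ∂pairLaw p q n ≤
      2 * n * ∑ i, (w i * m i) ^ 2 * r i := by
    refine (integral_sum_mul_countDiff_sub_sq_le p q n (fun i => w i * m i) (n * S)).trans_eq ?_
    simp [hSm, hr, hm]
  rw [integral_prod _ .of_finite]
  refine (integral_mono .of_finite .of_finite hcond).trans ?_
  rw [integral_add .of_finite .of_finite, integral_const_mul, integral_const_mul]
  refine (add_le_add (mul_le_mul_of_nonneg_left hfirst (by positivity))
    (mul_le_mul_of_nonneg_left hsecond (by positivity))).trans_eq ?_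
  ring

lemma integral_stat_sub_sq_le {w : ι → ℝ} (hw : ∀ i, 0 ≤ w i) :
    ∫ ω, (stat w ω.1 ω.2 - n ^ 2 * weightedSqDist w p q) ^ 2
        ∂(pairLaw p q n).prod (pairLaw p q n) ≤
      4 * n ^ 2 * weightedCollision w p q +
        4 * n ^ 3 * (√(weightedCollision w p q) * weightedSqDist w p q) := by
  refine (integral_stat_sub_sq_le_sum p q n w).trans ?_
  gcongr
  rw [weightedSqDist, Finset.mul_sum]
  refine Finset.sum_le_sum fun i _ => ?_
  calc (w i * (p.real {i} - q.real {i})) ^ 2 * (p.real {i} + q.real {i})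
      = w i * (p.real {i} + q.real {i}) * (w i * (p.real {i} - q.real {i}) ^ 2) := by ring
    _ ≤ √(weightedCollision w p q) * (w i * (p.real {i} - q.real {i}) ^ 2) :=
        mul_le_mul_of_nonneg_right (mul_measureReal_add_le_sqrt_weightedCollision w p q i)
          (mul_nonneg (hw i) (sq_nonneg _))

lemma inv_one_add_le {a N : ℝ} (ha : 0 ≤ a) (hN : 0 < N) :
    (1 + a)⁻¹ ≤ 2 / N + 4 / N ^ 2 * (a - N) ^ 2 := by
  rcases le_total (N / 2) a with h | h
  · have : (1 + a)⁻¹ ≤ 2 / N := by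
      rw [inv_eq_one_div, div_le_div_iff₀ (by positivity) hN]
      linarith
    exact this.trans (le_add_of_nonneg_right (by positivity))
  · have hdev : 1 ≤ 4 / N ^ 2 * (a - N) ^ 2 := by
      rw [div_mul_eq_mul_div, one_le_div₀ (by positivity)]
      nlinarith
    have : (1 + a)⁻¹ ≤ 1 := inv_le_one_of_one_le₀ (by linarith)
    exact (this.trans hdev).trans (le_add_of_nonneg_left (by positivity))

omit [Fintype ι] in
lemma integral_hitCount_sub_sq_le [Finite ι] (i : ι) :
    ∫ ω, (hitCount ω i - n * (p.real {i} + q.real {i})) ^ 2 ∂pairLaw p q n ≤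
      2 * (n * (p.real {i} + q.real {i})) := by
  have := Fintype.ofFinite ι
  let e (z : ι × ι) : ℝ := (if z.1 = i then 1 else 0) + (if z.2 = i then 1 else 0)
  have hmean : ∫ z, e z ∂(p.prod q) = p.real {i} + q.real {i} := by
    refine (integral_fst_add_snd p q (fun j => if j = i then 1 else 0)
      fun j => if j = i then 1 else 0).trans ?_
    simp [Finset.sum_add_distrib]
  have hsq : ∫ z, e z ^ 2 ∂(p.prod q) ≤ 2 * (p.real {i} + q.real {i}) := by
    rw [← hmean, ← integral_const_mul]
    refine integral_mono .of_finite .of_finite fun z => ?_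
    dsimp only [e]
    split_ifs <;> norm_num
  have h := integral_sum_pi_sub_sq_le (κ := Fin n) (μ := p.prod q) (h := e) .of_discrete
    (n * (p.real {i} + q.real {i}))
  rw [Fintype.card_fin, hmean, sub_self, zero_pow two_ne_zero, add_zero] at h
  refine h.trans ?_
  rw [mul_left_comm]
  gcongr

variable {n}

omit [Fintype ι] in
lemma integral_weight_mul_le [Finite ι] (hn : 0 < n) (i : ι) :
    (∫ ω, weight ω i ∂pairLaw p q n) * (p.real {i} + q.real {i}) ≤ 10 / n := by
  have hr : 0 ≤ p.real {i} + q.real {i} := by positivity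
  rcases hr.eq_or_lt with hr0 | hr0
  · rw [← hr0, mul_zero]
    positivity
  set N := n * (p.real {i} + q.real {i}) with hN
  have hN0 : 0 < N := by positivity
  have hE : ∫ ω, weight ω i ∂pairLaw p q n ≤ 10 / N :=
    calc ∫ ω, weight ω i ∂pairLaw p q n
        ≤ ∫ ω, (2 / N + 4 / N ^ 2 * (hitCount ω i - N) ^ 2) ∂pairLaw p q n :=
          integral_mono .of_finite .of_finite fun ω =>
            inv_one_add_le (hitCount_nonneg ω i) hN0
      _ = 2 / N + 4 / N ^ 2 * ∫ ω, (hitCount ω i - N) ^ 2 ∂pairLaw p q n := by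
          rw [integral_add .of_finite .of_finite, integral_const_mul]
          simp
      _ ≤ 2 / N + 4 / N ^ 2 * (2 * N) := by
          gcongr
          exact integral_hitCount_sub_sq_le p q n i
      _ = 10 / N := by field_simp; norm_num
  calc (∫ ω, weight ω i ∂pairLaw p q n) * (p.real {i} + q.real {i})
      ≤ 10 / N * (p.real {i} + q.real {i}) := by gcongr
    _ = 10 / n := by rw [hN]; field_simp

lemma integral_weightedCollision_weight_le (hn : 0 < n) :
    ∫ ω, weightedCollision (weight ω) p q ∂pairLaw p q n ≤ 20 / n := by
  simp only [weightedCollision]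
  rw [integral_finsetSum _ fun _ _ => .of_finite]
  calc ∑ i, ∫ ω, (weight ω i * (p.real {i} + q.real {i})) ^ 2 ∂pairLaw p q n
      ≤ ∑ i, ∫ ω, weight ω i * (p.real {i} + q.real {i}) ^ 2 ∂pairLaw p q n := by
        refine Finset.sum_le_sum fun i _ => integral_mono .of_finite .of_finite fun ω => ?_
        dsimp only
        rw [mul_pow]
        gcongr
        exact pow_le_of_le_one (weight_pos ω i).le (weight_le_one ω i) two_ne_zero
    _ = ∑ i, (∫ ω, weight ω i ∂pairLaw p q n) * (p.real {i} + q.real {i}) *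
          (p.real {i} + q.real {i}) := by
        simp only [integral_mul_const, sq, mul_assoc]
    _ ≤ ∑ i, 10 / n * (p.real {i} + q.real {i}) := by
        gcongr with i
        exact integral_weight_mul_le p q hn i
    _ = 20 / n := by
        rw [← Finset.mul_sum, Finset.sum_add_distrib, sum_measureReal_singleton,
          sum_measureReal_singleton, Finset.coe_univ, probReal_univ, probReal_univ]
        ring

lemma measureReal_weightedCollision_weight_ge_le (hn : 0 < n) :
    (pairLaw p q n).real {ω | 180 / n ≤ weightedCollision (weight ω) p q} ≤ 1 / 9 := by
  have hn' : (0 : ℝ) < n := by exact_mod_cast hn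
  have h := (mul_meas_ge_le_integral_of_nonneg
    (.of_forall fun ω => weightedCollision_nonneg (weight ω) p q) .of_finite
    (180 / (n : ℝ))).trans (integral_weightedCollision_weight_le p q hn)
  rw [div_mul_eq_mul_div, div_le_div_iff_of_pos_right hn'] at h
  linarith

variable {p q}

lemma measureReal_stat_deviation_le {w : ι → ℝ} (hn : 0 < n) (hw : ∀ i, 0 ≤ w i)
    (hB : weightedCollision w p q ≤ 180 / n) {t : ℝ} (ht : 0 < t) :
    ((pairLaw p q n).prod (pairLaw p q n)).real
        {ω | t ≤ |stat w ω.1 ω.2 - n ^ 2 * weightedSqDist w p q|} ≤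
      (720 * n + 56 * n ^ 2 * (√n * weightedSqDist w p q)) / t ^ 2 := by
  have hn' : (0 : ℝ) < n := by exact_mod_cast hn
  have hS := weightedSqDist_nonneg hw p q
  have hsqrt : n * √(weightedCollision w p q) ≤ 14 * √n := by
    rw [← sq_le_sq₀ (by positivity) (by positivity), mul_pow, mul_pow,
      Real.sq_sqrt (weightedCollision_nonneg w p q), Real.sq_sqrt hn'.le]
    calc (n : ℝ) ^ 2 * weightedCollision w p q ≤ (n : ℝ) ^ 2 * (180 / n) := by gcongr
      _ ≤ 14 ^ 2 * (n : ℝ) := by field_simp; norm_num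
  refine (measureReal_le_abs_sub_le ht .of_finite).trans ?_
  gcongr
  refine (integral_stat_sub_sq_le p q n hw).trans (add_le_add ?_ ?_)
  · calc 4 * (n : ℝ) ^ 2 * weightedCollision w p q ≤ 4 * (n : ℝ) ^ 2 * (180 / n) := by gcongr
      _ = 720 * (n : ℝ) := by field_simp; norm_num
  · calc 4 * (n : ℝ) ^ 3 * (√(weightedCollision w p q) * weightedSqDist w p q)
        = 4 * n ^ 2 * (n * √(weightedCollision w p q) * weightedSqDist w p q) := by ring
      _ ≤ 4 * n ^ 2 * (14 * √n * weightedSqDist w p q) := by gcongr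
      _ = 56 * n ^ 2 * (√n * weightedSqDist w p q) := by ring

lemma pos_of_le_mul_pow_four {δ : ℝ} (hn : 10 ^ 8 ≤ n * δ ^ 4) : 0 < n := by
  refine Nat.pos_of_ne_zero fun h => ?_
  norm_num [h] at hn

theorem measureReal_rejectSet_le {δ : ℝ} (hδ : 0 < δ) (hn : 10 ^ 8 ≤ n * δ ^ 4) :
    ((pairLaw p p n).prod ((pairLaw p p n).prod (pairLaw p p n))).real (rejectSet ι n δ) ≤
      2 / 9 := by
  have hn0 := pos_of_le_mul_pow_four hn
  have hn' : (0 : ℝ) < n := by exact_mod_cast hn0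
  refine (measureReal_prod_le_add (a := 1 / 9) (b := 1 / 9) (Set.toFinite _).measurableSet
    (by norm_num) (measureReal_weightedCollision_weight_ge_le p p hn0)
    fun ω hω => ?_).trans (by norm_num)
  have hS : weightedSqDist (weight ω) p p = 0 := by simp [weightedSqDist]
  have hdev := measureReal_stat_deviation_le hn0 (fun i => (weight_pos ω i).le)
    (not_le.1 hω).le (t := n * δ ^ 2 / 8) (by positivity)
  simp only [hS, mul_zero, sub_zero, add_zero] at hdev
  refine (measureReal_mono ?_).trans (hdev.trans ?_)
  · exact fun η (hη : n * δ ^ 2 / 8 < stat (weight ω) η.1 η.2) =>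
      hη.le.trans (le_abs_self _)
  · rw [div_pow, div_div_eq_mul_div, div_le_div_iff₀ (by positivity) (by norm_num)]
    nlinarith [mul_le_mul_of_nonneg_left hn hn'.le]

theorem measureReal_rejectSet_compl_le {δ : ℝ} (hδ : 0 < δ) (hn : 10 ^ 8 ≤ n * δ ^ 4)
    (hcard : Fintype.card ι ≤ n + 1) (hfar : δ ≤ ∑ i, |p.real {i} - q.real {i}|) :
    ((pairLaw p q n).prod ((pairLaw p q n).prod (pairLaw p q n))).real (rejectSet ι n δ)ᶜ ≤
      2 / 9 := by
  have hn0 := pos_of_le_mul_pow_four hn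
  have hn' : (0 : ℝ) < n := by exact_mod_cast hn0
  refine (measureReal_prod_le_add (a := 1 / 9) (b := 1 / 9) (Set.toFinite _).measurableSet
    (by norm_num) (measureReal_weightedCollision_weight_ge_le p q hn0)
    fun ω hω => ?_).trans (by norm_num)
  have hfarω := sq_le_mul_weightedSqDist_weight hn0 hcard hδ.le hfar ω
  have hdev (t : ℝ) := measureReal_stat_deviation_le (t := t) hn0
    (fun i => (weight_pos ω i).le) (not_le.1 hω).le
  set S := weightedSqDist (weight ω) p q
  have hS : 0 < S := pos_of_mul_pos_right ((by positivity : 0 < δ ^ 2).trans_le hfarω)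
    (by positivity)
  refine (measureReal_mono fun η hη => ?_).trans
    ((hdev (n ^ 2 * S / 2) (by positivity)).trans ?_)
  · have hη' : stat (weight ω) η.1 η.2 ≤ n * δ ^ 2 / 8 := not_lt.1 hη
    have : n * δ ^ 2 / 8 ≤ n ^ 2 * S / 2 := by nlinarith
    rw [Set.mem_ofPred_eq, abs_sub_comm]
    exact le_abs.2 (.inl (by linarith))
  · have hrn : √(n : ℝ) ^ 2 = n := Real.sq_sqrt hn'.le
    have hy : 2500 ≤ √n * (n * S) := by
      have hδn : 10 ^ 4 ≤ √n * δ ^ 2 := by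
        rw [← sq_le_sq₀ (by positivity) (by positivity), mul_pow, hrn, ← pow_mul, ← pow_mul]
        exact_mod_cast hn
      nlinarith [mul_le_mul_of_nonneg_left hfarω (Real.sqrt_nonneg (n : ℝ))]
    set y := √n * (n * S) with hy
    have hnum : (720 * n + 56 * n ^ 2 * (√n * S)) * 9 = n * (6480 + 504 * y) := by
      rw [hy]; ring
    have hden : (n ^ 2 * S / 2) ^ 2 = n * (y ^ 2 / 4) := by
      rw [hy, mul_pow, hrn]; ring
    rw [div_le_div_iff₀ (by positivity) (by norm_num), hnum, one_mul, hden]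
    gcongr
    nlinarith

end FiniteDomain

section Transport

variable {X : Type*} [PseudoEMetricSpace X] [MeasurableSpace X]

lemma EMD_le_lintegral (γ : Measure (X × X)) :
    EMD γ.fst γ.snd ≤ ∫⁻ z, edist z.1 z.2 ∂γ :=
  iInf_le_of_le ⟨γ, rfl, rfl⟩ le_rfl

lemma EMD_zero : EMD (0 : Measure X) 0 = 0 := by
  simpa using EMD_le_lintegral (0 : Measure (X × X))

lemma EMD_add_le (μ₁ ν₁ μ₂ ν₂ : Measure X) :
    EMD (μ₁ + μ₂) (ν₁ + ν₂) ≤ EMD μ₁ ν₁ + EMD μ₂ ν₂ := by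
  refine ENNReal.le_iInf_add_iInf fun γ₁ γ₂ => ?_
  obtain ⟨γ₁, rfl, rfl⟩ := γ₁
  obtain ⟨γ₂, rfl, rfl⟩ := γ₂
  rw [← Measure.fst_add, ← Measure.snd_add, ← lintegral_add_measure]
  exact EMD_le_lintegral (γ₁ + γ₂)

lemma EMD_sum_le {ι : Type*} (s : Finset ι) (μ ν : ι → Measure X) :
    EMD (∑ i ∈ s, μ i) (∑ i ∈ s, ν i) ≤ ∑ i ∈ s, EMD (μ i) (ν i) := by
  classical
  induction s using Finset.induction_on with
  | empty => simp [EMD_zero]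
  | insert i s hi ih =>
    rw [Finset.sum_insert hi, Finset.sum_insert hi, Finset.sum_insert hi]
    exact (EMD_add_le _ _ _ _).trans (by gcongr)

lemma EMD_le_of_edist_le {μ ν : Measure X} {m : ℝ≥0∞} (hμ : μ Set.univ = m)
    (hν : ν Set.univ = m) (hm : m ≠ ∞) {s t : Set X} (hs : ∀ᵐ x ∂μ, x ∈ s)
    (ht : ∀ᵐ y ∂ν, y ∈ t) {D : ℝ≥0∞} (hD : ∀ x ∈ s, ∀ y ∈ t, edist x y ≤ D) :
    EMD μ ν ≤ D * m := by
  have : IsFiniteMeasure μ := ⟨hμ.trans_lt hm.lt_top⟩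
  have : IsFiniteMeasure ν := ⟨hν.trans_lt hm.lt_top⟩
  rcases eq_or_ne m 0 with rfl | h0
  · rw [Measure.measure_univ_eq_zero.1 hμ, Measure.measure_univ_eq_zero.1 hν, EMD_zero]
    exact zero_le
  have hinv : m⁻¹ * m = 1 := ENNReal.inv_mul_cancel h0 hm
  set γ := m⁻¹ • μ.prod ν with hγ
  have hfst : γ.fst = μ := by
    rw [hγ, Measure.fst, Measure.map_smul, Measure.map_fst_prod, hν, smul_smul, hinv, one_smul]
  have hsnd : γ.snd = ν := by
    rw [hγ, Measure.snd, Measure.map_smul, Measure.map_snd_prod, hμ, smul_smul, hinv, one_smul]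
  have hbound : ∀ᵐ z ∂γ, edist z.1 z.2 ≤ D := by
    refine Measure.ae_smul_measure ?_ _
    filter_upwards [Measure.quasiMeasurePreserving_fst.ae hs,
      Measure.quasiMeasurePreserving_snd.ae ht] with z hz₁ hz₂
    exact hD _ hz₁ _ hz₂
  calc EMD μ ν = EMD γ.fst γ.snd := by rw [hfst, hsnd]
    _ ≤ ∫⁻ z, edist z.1 z.2 ∂γ := EMD_le_lintegral γ
    _ ≤ ∫⁻ _, D ∂γ := lintegral_mono_ae hbound
    _ = D * m := by rw [lintegral_const, ← Measure.fst_univ, hfst, hμ]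

end Transport

section Fibers

variable {X : Type*} [MeasurableSpace X]

lemma smul_cond_univ {p : Measure X} [IsFiniteMeasure p] {s : Set X} {a : ℝ≥0∞} (ha : a ≤ p s) :
    (a • p[|s]) Set.univ = a := by
  rcases eq_or_ne (p s) 0 with h | h
  · simp [le_zero_iff.1 (ha.trans h.le)]
  · have := cond_isProbabilityMeasure h
    simp

variable {ι : Type*} [MeasurableSpace ι] [MeasurableSingletonClass ι] {φ : X → ι}

lemma ae_mem_inter_fiber {μ : Measure X} {s : Set X} (hφ : Measurable φ) (hs : ∀ᵐ x ∂μ, x ∈ s)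
    (a : ℝ≥0∞) (i : ι) : ∀ᵐ x ∂(a • μ[|φ ⁻¹' {i}]), x ∈ s ∩ φ ⁻¹' {i} :=
  Measure.ae_smul_measure (Filter.Eventually.and (cond_absolutelyContinuous.ae_le hs)
    (ae_cond_mem (hφ (measurableSet_singleton i)))) a

variable [Fintype ι]

lemma sum_smul_cond_add (p : Measure X) [IsFiniteMeasure p] (hφ : Measurable φ) (b : ι → ℝ≥0∞) :
    ∑ i, min (p (φ ⁻¹' {i})) (b i) • p[|φ ⁻¹' {i}] +
      ∑ i, (p (φ ⁻¹' {i}) - b i) • p[|φ ⁻¹' {i}] = p := by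
  rw [← Finset.sum_add_distrib]
  conv_rhs => rw [← sum_meas_smul_cond_fiber hφ p]
  simp only [← add_smul, add_comm (min _ _), tsub_add_min]

lemma sum_tsub_measure_fiber_comm (p q : Measure X) [IsProbabilityMeasure p]
    [IsProbabilityMeasure q] (hφ : Measurable φ) :
    ∑ i, (p (φ ⁻¹' {i}) - q (φ ⁻¹' {i})) = ∑ i, (q (φ ⁻¹' {i}) - p (φ ⁻¹' {i})) := by
  have htotal (μ : Measure X) [IsProbabilityMeasure μ] : ∑ i, μ (φ ⁻¹' {i}) = 1 := by
    rw [sum_measure_preimage_singleton _ fun i _ => hφ (measurableSet_singleton i)]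
    simp
  have hmax : ∑ i, p (φ ⁻¹' {i}) + ∑ i, (q (φ ⁻¹' {i}) - p (φ ⁻¹' {i})) =
      ∑ i, q (φ ⁻¹' {i}) + ∑ i, (p (φ ⁻¹' {i}) - q (φ ⁻¹' {i})) := by
    simp only [← Finset.sum_add_distrib, add_tsub_eq_max, max_comm]
  rw [htotal p, htotal q] at hmax
  exact ((ENNReal.add_right_inj ENNReal.one_ne_top).1 hmax).symm

variable [PseudoEMetricSpace X]

/- Match as much mass as possible inside each fiber and transport the rest arbitrarily. -/
lemma EMD_le_of_fibers {p q : Measure X} [IsProbabilityMeasure p] [IsProbabilityMeasure q]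
    (hφ : Measurable φ) {s : Set X} (hp : ∀ᵐ x ∂p, x ∈ s) (hq : ∀ᵐ x ∂q, x ∈ s) {D : ℝ≥0∞}
    (hD : ∀ x ∈ s, ∀ y ∈ s, edist x y ≤ D) {c : ι → ℝ≥0∞}
    (hc : ∀ x ∈ s, ∀ y ∈ s, φ x = φ y → edist x y ≤ c (φ x)) :
    EMD p q ≤ ∑ i, c i * min (p (φ ⁻¹' {i})) (q (φ ⁻¹' {i})) +
      D * ∑ i, (p (φ ⁻¹' {i}) - q (φ ⁻¹' {i})) := by
  set P : ι → ℝ≥0∞ := fun i => p (φ ⁻¹' {i})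
  set Q : ι → ℝ≥0∞ := fun i => q (φ ⁻¹' {i})
  have hmatched (i : ι) :
      EMD (min (P i) (Q i) • p[|φ ⁻¹' {i}]) (min (Q i) (P i) • q[|φ ⁻¹' {i}]) ≤
        c i * min (P i) (Q i) := by
    refine EMD_le_of_edist_le (smul_cond_univ (min_le_left _ _))
      ((smul_cond_univ (min_le_left _ _)).trans (min_comm _ _))
      ((min_le_left _ _).trans_lt (measure_lt_top p _)).ne
      (ae_mem_inter_fiber hφ hp _ i) (ae_mem_inter_fiber hφ hq _ i) ?_
    rintro x ⟨hx, rfl⟩ y ⟨hy, hxy⟩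
    exact hc x hx y hy hxy.symm
  have hmass (μ : Measure X) [IsFiniteMeasure μ] (b : ι → ℝ≥0∞) :
      (∑ i, (μ (φ ⁻¹' {i}) - b i) • μ[|φ ⁻¹' {i}]) Set.univ = ∑ i, (μ (φ ⁻¹' {i}) - b i) := by
    rw [Measure.finsetSum_apply]
    exact Finset.sum_congr rfl fun i _ => smul_cond_univ tsub_le_self
  have hmem (μ : Measure X) (hμ : ∀ᵐ x ∂μ, x ∈ s) (b : ι → ℝ≥0∞) :
      ∀ᵐ x ∂∑ i, b i • μ[|φ ⁻¹' {i}], x ∈ s :=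
    ae_finsetSum_measure_iff.2 fun i _ => (ae_mem_inter_fiber hφ hμ _ i).mono fun _ hx => hx.1
  have hfinite : ∑ i, (P i - Q i) ≠ ∞ := ENNReal.sum_ne_top.2 fun i _ =>
    (tsub_le_self.trans_lt (measure_lt_top p _)).ne
  calc EMD p q
      = EMD (∑ i, min (P i) (Q i) • p[|φ ⁻¹' {i}] + ∑ i, (P i - Q i) • p[|φ ⁻¹' {i}])
          (∑ i, min (Q i) (P i) • q[|φ ⁻¹' {i}] + ∑ i, (Q i - P i) • q[|φ ⁻¹' {i}]) := by
        rw [sum_smul_cond_add p hφ Q, sum_smul_cond_add q hφ P]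
    _ ≤ ∑ i, EMD (min (P i) (Q i) • p[|φ ⁻¹' {i}]) (min (Q i) (P i) • q[|φ ⁻¹' {i}]) +
          EMD (∑ i, (P i - Q i) • p[|φ ⁻¹' {i}]) (∑ i, (Q i - P i) • q[|φ ⁻¹' {i}]) :=
        (EMD_add_le _ _ _ _).trans (by gcongr; exact EMD_sum_le _ _ _)
    _ ≤ ∑ i, c i * min (P i) (Q i) + D * ∑ i, (P i - Q i) := by
        refine add_le_add (Finset.sum_le_sum fun i _ => hmatched i) ?_
        exact EMD_le_of_edist_le (hmass p Q)
          ((hmass q P).trans (sum_tsub_measure_fiber_comm p q hφ).symm) hfinite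
          (hmem p hp _) (hmem q hq _) hD

lemma sum_measure_singleton_tsub (μ ν : Measure ι) [IsProbabilityMeasure μ]
    [IsProbabilityMeasure ν] :
    ∑ i, (μ {i} - ν {i}) = ENNReal.ofReal ((∑ i, |μ.real {i} - ν.real {i}|) / 2) := by
  have hpos (i : ι) : μ {i} - ν {i} = ENNReal.ofReal (max (μ.real {i} - ν.real {i}) 0) := by
    rw [ENNReal.ofReal_max, ENNReal.ofReal_zero, max_eq_left zero_le,
      ENNReal.ofReal_sub _ measureReal_nonneg, ofReal_measureReal, ofReal_measureReal]
  have hsum : ∑ i, (μ.real {i} - ν.real {i}) = 0 := by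
    rw [Finset.sum_sub_distrib, sum_measureReal_singleton, sum_measureReal_singleton]
    simp
  simp only [hpos]
  rw [← ENNReal.ofReal_sum_of_nonneg fun i _ => le_max_right _ _]
  congr 1
  have hmax (a : ℝ) : max a 0 = (|a| + a) / 2 := by
    linarith [max_zero_add_max_neg_zero_eq_abs_self a, max_zero_sub_max_neg_zero_eq_self a]
  simp only [hmax]
  rw [← Finset.sum_div, Finset.sum_add_distrib, hsum, add_zero]

end Fibers

section Cover

variable {X : Type*} [PseudoMetricSpace X] {n : ℕ}

open Classical in
/-- The index of the first point of `z` within distance `r` of `x`, or `Fin.last n` if there is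
none. Its fibers are the cells of the partition built from the sample `z`; the last cell consists
of the points that `z` leaves uncovered. -/
def firstNear (r : ℝ) (z : Fin n → X) (x : X) : Fin (n + 1) :=
  Fin.find (fun j => ∀ i : Fin n, i.castSucc = j → dist x (z i) ≤ r)
    ⟨Fin.last n, fun i hi => absurd hi i.castSucc_ne_last⟩

lemma firstNear_eq_castSucc_iff {r : ℝ} {z : Fin n → X} {x : X} {j : Fin n} :
    firstNear r z x = j.castSucc ↔ dist x (z j) ≤ r ∧ ∀ i < j, r < dist x (z i) := by
  rw [firstNear, Fin.find_eq_iff]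
  simp [Fin.forall_fin_succ', Fin.castSucc_lt_castSucc_iff, not_lt.2 (Fin.le_last _)]

lemma firstNear_eq_last_iff {r : ℝ} {z : Fin n → X} {x : X} :
    firstNear r z x = Fin.last n ↔ ∀ j, r < dist x (z j) := by
  rw [firstNear, Fin.find_eq_iff]
  simp [Fin.forall_fin_succ', Fin.castSucc_lt_last, Fin.castSucc_ne_last]

lemma dist_le_of_firstNear_eq {r : ℝ} {z : Fin n → X} {x y : X}
    (hxy : firstNear r z x = firstNear r z y) (hx : firstNear r z x ≠ Fin.last n) :
    dist x y ≤ 2 * r := by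
  obtain ⟨j, hj⟩ := Fin.exists_castSucc_eq.2 hx
  have hxj := (firstNear_eq_castSucc_iff.1 hj.symm).1
  have hyj := (firstNear_eq_castSucc_iff.1 (hxy.symm.trans hj.symm)).1
  linarith [dist_triangle_right x y (z j)]

lemma mul_one_sub_pow_le {a : ℝ} (h₀ : 0 ≤ a) (h₁ : a ≤ 1) (hn : 0 < n) :
    a * (1 - a) ^ n ≤ 1 / n := by
  have hn' : (0 : ℝ) < n := by exact_mod_cast hn
  have hpow : 0 ≤ (1 - a) ^ n := pow_nonneg (by linarith) n
  rw [le_div_iff₀ hn']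
  calc a * (1 - a) ^ n * n ≤ (1 - a) ^ n * (1 + n * a) := by linarith
    _ ≤ (1 - a) ^ n * (1 + a) ^ n := by
        gcongr
        exact one_add_mul_le_pow (by linarith) n
    _ = (1 - a ^ 2) ^ n := by rw [← mul_pow]; ring
    _ ≤ 1 := pow_le_one₀ (by nlinarith) (by nlinarith)

variable [MeasurableSpace X]

lemma setLIntegral_closedBall_compl_pow_le (p : Measure X) [IsProbabilityMeasure p] {s : Set X}
    (hs : MeasurableSet s) {r : ℝ} (hr : ∀ x ∈ s, ∀ y ∈ s, dist x y ≤ r) (hn : 0 < n) :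
    ∫⁻ x in s, p (Metric.closedBall x r)ᶜ ^ n ∂p ≤ ENNReal.ofReal (1 / n) := by
  calc ∫⁻ x in s, p (Metric.closedBall x r)ᶜ ^ n ∂p
      ≤ ∫⁻ _ in s, p sᶜ ^ n ∂p := by
        refine setLIntegral_mono' hs fun x hx => ?_
        gcongr
        exact fun y hy => hr y hy x hx
    _ = p s * p sᶜ ^ n := by rw [setLIntegral_const, mul_comm]
    _ = ENNReal.ofReal (p.real s * (1 - p.real s) ^ n) := by
        rw [← probReal_compl_eq_one_sub hs, ENNReal.ofReal_mul measureReal_nonneg,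
          ENNReal.ofReal_pow measureReal_nonneg, ofReal_measureReal, ofReal_measureReal]
    _ ≤ ENNReal.ofReal (1 / n) := ENNReal.ofReal_le_ofReal
        (mul_one_sub_pow_le measureReal_nonneg measureReal_le_one hn)

variable [OpensMeasurableSpace X]

lemma lintegral_closedBall_compl_pow_le (p : Measure X) [IsProbabilityMeasure p] {k : ℕ} {r : ℝ}
    {K : Fin k → Set X} (hK : p (⋃ i, K i)ᶜ = 0)
    (hr : ∀ i, ∀ x ∈ K i, ∀ y ∈ K i, dist x y ≤ r) (hn : 0 < n) :
    ∫⁻ x, p (Metric.closedBall x r)ᶜ ^ n ∂p ≤ ENNReal.ofReal (k / n) := by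
  have hclosure (i : Fin k) (x) (hx : x ∈ closure (K i)) (y) (hy : y ∈ closure (K i)) :
      dist x y ≤ r := by
    have hsub : closure (K i ×ˢ K i) ⊆ {a : X × X | dist a.1 a.2 ≤ r} :=
      closure_minimal (fun a ha => hr i _ ha.1 _ ha.2)
        (isClosed_le continuous_dist continuous_const)
    have hmem : (x, y) ∈ closure (K i ×ˢ K i) := by
      rw [closure_prod_eq]
      exact ⟨hx, hy⟩
    exact hsub hmem
  have hrestrict : p.restrict (⋃ i, closure (K i)) = p :=
    Measure.restrict_eq_self_of_ae_mem <| measure_mono_null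
      (Set.compl_subset_compl.2 (Set.iUnion_mono fun i => subset_closure)) hK
  calc ∫⁻ x, p (Metric.closedBall x r)ᶜ ^ n ∂p
      = ∫⁻ x in ⋃ i, closure (K i), p (Metric.closedBall x r)ᶜ ^ n ∂p := by rw [hrestrict]
    _ ≤ ∑' i, ∫⁻ x in closure (K i), p (Metric.closedBall x r)ᶜ ^ n ∂p := lintegral_iUnion_le _ _
    _ ≤ ∑' _ : Fin k, ENNReal.ofReal (1 / n) := ENNReal.tsum_le_tsum fun i =>
        setLIntegral_closedBall_compl_pow_le p isClosed_closure.measurableSet (hclosure i) hn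
    _ = ENNReal.ofReal (k / n) := by
        rw [tsum_fintype, Fin.sum_const, ← ENNReal.ofReal_nsmul, nsmul_eq_mul, mul_one_div]

variable [SecondCountableTopology X]

lemma measurable_firstNear (r : ℝ) :
    Measurable fun a : (Fin n → X) × X => firstNear r a.1 a.2 := by
  have hdist (i : Fin n) : Measurable fun a : (Fin n → X) × X => dist a.2 (a.1 i) :=
    measurable_snd.dist ((measurable_pi_apply i).comp measurable_fst)
  have hfar (i : Fin n) : MeasurableSet {a : (Fin n → X) × X | r < dist a.2 (a.1 i)} :=
    measurableSet_lt measurable_const (hdist i)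
  refine measurable_to_countable' fun j => ?_
  induction j using Fin.lastCases with
  | last =>
    simpa only [Set.preimage, Set.mem_singleton_iff, firstNear_eq_last_iff, Set.ofPred_forall]
      using MeasurableSet.iInter hfar
  | cast j =>
    simpa only [Set.preimage, Set.mem_singleton_iff, firstNear_eq_castSucc_iff, Set.ofPred_and,
      Set.ofPred_forall] using (measurableSet_le (hdist j) measurable_const).inter
        (MeasurableSet.iInter fun i => .iInter fun _ => hfar i)

lemma lintegral_uncovered_eq (p : Measure X) [IsProbabilityMeasure p] (r : ℝ) :
    ∫⁻ z, p (firstNear r z ⁻¹' {Fin.last n}) ∂(Measure.pi fun _ : Fin n => p) =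
      ∫⁻ x, p (Metric.closedBall x r)ᶜ ^ n ∂p := by
  have hmeas : MeasurableSet ((fun a : (Fin n → X) × X => firstNear r a.1 a.2) ⁻¹' {Fin.last n}) :=
    measurable_firstNear r (measurableSet_singleton _)
  have hsection (x : X) : (fun z : Fin n → X => (z, x)) ⁻¹'
      ((fun a : (Fin n → X) × X => firstNear r a.1 a.2) ⁻¹' {Fin.last n}) =
      Set.univ.pi fun _ => (Metric.closedBall x r)ᶜ := by
    ext z
    simp [firstNear_eq_last_iff, dist_comm x]
  refine (Measure.prod_apply hmeas).symm.trans ((Measure.prod_apply_symm hmeas).trans ?_)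
  simp only [hsection, Measure.pi_pi, Finset.prod_const, Finset.card_univ, Fintype.card_fin]

lemma measurable_uncovered (p : Measure X) [SFinite p] (r : ℝ) :
    Measurable fun z : Fin n → X => p (firstNear r z ⁻¹' {Fin.last n}) :=
  measurable_measure_prodMk_left (measurable_firstNear r (measurableSet_singleton _))

lemma measureReal_uncovered_ge_le (p : Measure X) [IsProbabilityMeasure p] {k : ℕ} {r : ℝ}
    {K : Fin k → Set X} (hK : p (⋃ i, K i)ᶜ = 0)
    (hr : ∀ i, ∀ x ∈ K i, ∀ y ∈ K i, dist x y ≤ r) (hn : 0 < n) {η : ℝ} (hη : 0 < η) :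
    (Measure.pi fun _ : Fin n => p).real {z | η ≤ p.real (firstNear r z ⁻¹' {Fin.last n})} ≤
      k / n / η := by
  have hset : {z : Fin n → X | η ≤ p.real (firstNear r z ⁻¹' {Fin.last n})} =
      {z | ENNReal.ofReal η ≤ p (firstNear r z ⁻¹' {Fin.last n})} := by
    ext z
    exact (ENNReal.ofReal_le_iff_le_toReal (measure_ne_top _ _)).symm
  have hmarkov := (mul_meas_ge_le_lintegral₀
    (measurable_uncovered p r).aemeasurable (ENNReal.ofReal η)).trans
    ((lintegral_uncovered_eq p r).trans_le (lintegral_closedBall_compl_pow_le p hK hr hn))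
  rw [hset, le_div_iff₀' hη]
  simpa [measureReal_def, hη.le] using ENNReal.toReal_le_of_le_ofReal (by positivity) hmarkov

lemma EMD_le_of_firstNear {p q : Measure X} [IsProbabilityMeasure p] [IsProbabilityMeasure q]
    {s : Set X} (hp : p sᶜ = 0) (hq : q sᶜ = 0) {M r : ℝ} (hM : 0 ≤ M) (hr : 0 ≤ r)
    (hs : ∀ x ∈ s, ∀ y ∈ s, dist x y ≤ M) (z : Fin n → X) :
    EMD p q ≤ ENNReal.ofReal (2 * r + M * (p.real (firstNear r z ⁻¹' {Fin.last n}) +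
      (∑ i, |(p.map (firstNear r z)).real {i} - (q.map (firstNear r z)).real {i}|) / 2)) := by
  set φ := firstNear r z
  have hφ : Measurable φ := (measurable_firstNear r).comp measurable_prodMk_left
  have := Measure.isProbabilityMeasure_map (μ := p) hφ.aemeasurable
  have := Measure.isProbabilityMeasure_map (μ := q) hφ.aemeasurable
  have hdiam (x) (hx : x ∈ s) (y) (hy : y ∈ s) : edist x y ≤ ENNReal.ofReal M := by
    rw [edist_dist]
    exact ENNReal.ofReal_le_ofReal (hs x hx y hy)
  have hcell (x) (hx : x ∈ s) (y) (hy : y ∈ s) (hxy : φ x = φ y) :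
      edist x y ≤ ENNReal.ofReal (2 * r) + if φ x = Fin.last n then ENNReal.ofReal M else 0 := by
    split_ifs with hlast
    · exact (hdiam x hx y hy).trans le_add_self
    · rw [edist_dist, add_zero]
      exact ENNReal.ofReal_le_ofReal (dist_le_of_firstNear_eq hxy hlast)
  have htv := sum_measure_singleton_tsub (p.map φ) (q.map φ)
  simp only [Measure.map_apply hφ (measurableSet_singleton _)] at htv
  have htotal : ∑ i, p (φ ⁻¹' {i}) = 1 := by
    rw [sum_measure_preimage_singleton _ fun i _ => hφ (measurableSet_singleton i)]
    simp
  calc EMD p q ≤ _ := EMD_le_of_fibers hφ hp hq hdiam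
        (c := fun i => ENNReal.ofReal (2 * r) + if i = Fin.last n then ENNReal.ofReal M else 0)
        hcell
    _ ≤ ∑ i, (ENNReal.ofReal (2 * r) + if i = Fin.last n then ENNReal.ofReal M else 0) *
          p (φ ⁻¹' {i}) + ENNReal.ofReal M * ∑ i, (p (φ ⁻¹' {i}) - q (φ ⁻¹' {i})) := by
        gcongr
        exact min_le_left _ _
    _ = _ := by
        simp only [add_mul, ite_mul, zero_mul, Finset.sum_add_distrib, Finset.sum_ite_eq',
          Finset.mem_univ, if_true]
        rw [← Finset.mul_sum, htotal, mul_one, htv, ← ofReal_measureReal (μ := p),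
          ENNReal.ofReal_add (by positivity) (by positivity), ENNReal.ofReal_mul hM,
          ENNReal.ofReal_add (by positivity) (by positivity), mul_add, add_assoc]

end Cover

section Blocks

variable {Z : Type*} [MeasurableSpace Z]

/-- Splitting a sample of size `m + n` into two consecutive blocks. -/
def splitBlocks (m n : ℕ) (ω : Fin (m + n) → Z) : (Fin m → Z) × (Fin n → Z) :=
  (fun i => ω (Fin.castAdd n i), fun j => ω (Fin.natAdd m j))

lemma measurePreserving_splitBlocks (μ : Measure Z) [SigmaFinite μ] (m n : ℕ) :
    MeasurePreserving (splitBlocks m n) (Measure.pi fun _ => μ)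
      ((Measure.pi fun _ => μ).prod (Measure.pi fun _ => μ)) :=
  (measurePreserving_sumPiEquivProdPi fun _ : Fin m ⊕ Fin n => μ).comp
    ((measurePreserving_piCongrLeft (fun _ => μ) finSumFinEquiv).symm _)

/-- Splitting a sample into four blocks of size `n`: one for the cells, one for the flattening
weights, and two for the statistic. -/
def quarterBlocks (n : ℕ) (ω : Fin (n + (n + (n + n))) → Z) :
    (Fin n → Z) × (Fin n → Z) × (Fin n → Z) × (Fin n → Z) :=
  Prod.map id (Prod.map id (splitBlocks n n) ∘ splitBlocks n (n + n))
    (splitBlocks n (n + (n + n)) ω)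

lemma measurePreserving_quarterBlocks (μ : Measure Z) [SigmaFinite μ] (n : ℕ) :
    MeasurePreserving (quarterBlocks n) (Measure.pi fun _ => μ)
      ((Measure.pi fun _ => μ).prod ((Measure.pi fun _ => μ).prod
        ((Measure.pi fun _ => μ).prod (Measure.pi fun _ => μ)))) := by
  have hid := MeasurePreserving.id (Measure.pi fun _ : Fin n => μ)
  exact (hid.prod ((hid.prod (measurePreserving_splitBlocks μ n n)).comp
    (measurePreserving_splitBlocks μ n (n + n)))).comp
      (measurePreserving_splitBlocks μ n (n + (n + n)))

lemma measurable_quarterBlocks (n : ℕ) : Measurable (quarterBlocks (Z := Z) n) := by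
  unfold quarterBlocks splitBlocks
  fun_prop

end Blocks

section RejectTester

variable {X : Type*} [MeasurableSpace X] {N : ℕ}

/-- Pairing the `i`-th sample of the first kind with the `i`-th sample of the second kind. -/
def pairSamples (s : (Fin N → X) × (Fin N → X)) : Fin N → X × X := fun i => (s.1 i, s.2 i)

lemma measurePreserving_pairSamples (p q : Measure X) [SigmaFinite p] [SigmaFinite q] :
    MeasurePreserving pairSamples ((Measure.pi fun _ => p).prod (Measure.pi fun _ => q))
      (pairLaw p q N) :=
  (measurePreserving_arrowProdEquivProdArrow X X (Fin N) (fun _ => p) fun _ => q).symm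

lemma measurable_pairSamples : Measurable (pairSamples (X := X) (N := N)) := by
  unfold pairSamples
  fun_prop

variable {A : Set (Fin N → X × X)}

open Classical in
/-- The deterministic tester that draws `N` samples of each kind and rejects if and only if the
paired sample lies in `A`. -/
def rejectTester (hA : MeasurableSet A) : SampleTester X where
  n := N
  rule := Kernel.deterministic (fun s => if pairSamples s ∈ A then false else true)
    (Measurable.ite (measurable_pairSamples hA) measurable_const measurable_const)
  markov := inferInstance

lemma rejectTester_answerLaw (hA : MeasurableSet A) (p q : Measure X) [SigmaFinite p]
    [SigmaFinite q] (b : Bool) :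
    (rejectTester hA).answerLaw p q {b} = pairLaw p q N (if b then Aᶜ else A) := by
  classical
  have hmeas : Measurable fun s : (Fin N → X) × (Fin N → X) =>
      if pairSamples s ∈ A then false else true :=
    Measurable.ite (measurable_pairSamples hA) measurable_const measurable_const
  have hmap : (rejectTester hA).answerLaw p q =
      ((Measure.pi fun _ => p).prod (Measure.pi fun _ => q)).map
        fun s => if pairSamples s ∈ A then false else true :=
    Measure.deterministic_comp_eq_map hmeas
  rw [hmap, Measure.map_apply hmeas (measurableSet_singleton b),
    ← (measurePreserving_pairSamples p q).measure_preimage (by cases b <;> simp [hA])]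
  congr 1
  ext s
  cases b <;> simp

lemma two_thirds_le_of_measureReal_compl_le {Ω : Type*} [MeasurableSpace Ω] {μ : Measure Ω}
    [IsProbabilityMeasure μ] {s : Set Ω} (hs : MeasurableSet s) (h : μ.real sᶜ ≤ 1 / 3) :
    2 / 3 ≤ μ s := by
  rw [probReal_compl_eq_one_sub hs] at h
  have hreal : (2 / 3 : ℝ) ≤ μ.real s := by linarith
  simpa [ENNReal.ofReal_div_of_pos] using
    (ENNReal.ofReal_le_iff_le_toReal (measure_ne_top μ s)).2 hreal

lemma rejectTester_isEMDClosenessTester [PseudoEMetricSpace X] (hA : MeasurableSet A) {ε : ℝ}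
    {𝒜 : Set (Measure X × Measure X)}
    (hprob : ∀ p q, (p, q) ∈ 𝒜 → IsProbabilityMeasure p ∧ IsProbabilityMeasure q)
    (hcomplete : ∀ p, (p, p) ∈ 𝒜 → (pairLaw p p N).real A ≤ 1 / 3)
    (hsound : ∀ p q, (p, q) ∈ 𝒜 → ENNReal.ofReal ε < EMD p q →
      (pairLaw p q N).real Aᶜ ≤ 1 / 3) :
    (rejectTester hA).IsEMDClosenessTester ε 𝒜 := by
  intro p q hpq
  obtain ⟨hp, hq⟩ := hprob p q hpq
  refine ⟨?_, fun hfar => ?_⟩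
  · rintro rfl
    rw [rejectTester_answerLaw, if_pos rfl]
    refine two_thirds_le_of_measureReal_compl_le hA.compl ?_
    rw [compl_compl]
    exact hcomplete p hpq
  · rw [rejectTester_answerLaw, if_neg Bool.false_ne_true]
    exact two_thirds_le_of_measureReal_compl_le hA (hsound p q hpq hfar)

end RejectTester

section TrivialTester

variable {X : Type*} [MeasurableSpace X] [PseudoMetricSpace X]

/-- Pairs of Borel probability distributions on `Q` whose combined support can be partitioned into
`k` clusters of diameter at most `b`. This is `clusterablePairs` with an arbitrary set `Q` in place
of the cube. -/
def clusterablePairsIn (Q : Set X) (k : ℕ) (b : ℝ) : Set (Measure X × Measure X) :=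
  {pq | IsProbabilityMeasure pq.1 ∧ IsProbabilityMeasure pq.2 ∧ pq.1 Qᶜ = 0 ∧ pq.2 Qᶜ = 0 ∧
    Clusterable (pq.1.support ∪ pq.2.support) k b}

lemma rejectTester_empty_isEMDClosenessTester [SecondCountableTopology X] {Q : Set X}
    {k : ℕ} {M ε b : ℝ}
    (hQ : ∀ x ∈ Q, ∀ y ∈ Q, dist x y ≤ M) (h : k = 0 ∨ M ≤ ε) :
    (rejectTester (N := 0) (X := X) .empty).IsEMDClosenessTester ε
      (clusterablePairsIn Q k b) := by
  refine rejectTester_isEMDClosenessTester _ (fun p q h => ⟨h.1, h.2.1⟩)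
    (fun p _ => by simp) ?_
  rintro p q ⟨hp, hq, hpQ, hqQ, K, hK, -⟩ hfar
  rcases h with rfl | hMε
  · have hne : (p.support ∪ q.support).Nonempty :=
      (Measure.nonempty_support (IsProbabilityMeasure.ne_zero p)).mono Set.subset_union_left
    rw [← hK, Set.iUnion_of_empty] at hne
    exact absurd hne Set.not_nonempty_empty
  · have hEMD : EMD p q ≤ ENNReal.ofReal M * 1 :=
      EMD_le_of_edist_le measure_univ measure_univ ENNReal.one_ne_top hpQ hqQ fun x hx y hy => by
        rw [edist_dist]
        exact ENNReal.ofReal_le_ofReal (hQ x hx y hy)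
    rw [mul_one] at hEMD
    exact absurd hfar (not_lt.2 (hEMD.trans (ENNReal.ofReal_le_ofReal hMε)))

end TrivialTester

section CoverTester

variable {X : Type*} {n : ℕ}

/-- Replacing the points of a paired sample by their labels. -/
def relabel {ι : Type*} (φ : X → ι) (ω : Fin n → X × X) : Fin n → ι × ι :=
  fun s => Prod.map φ φ (ω s)

/-- The centers of the balls that define the cells: the first components of a paired sample. -/
def coverPoints (ω : Fin n → X × X) : Fin n → X := fun s => (ω s).1

/-- The rejection region of the cover tester. The first block defines the cells of radius `r`; the
others are relabelled by these cells and passed on to the tester for `ℓ₁` distance `δ`. -/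
def coverRejectSet (X : Type*) [PseudoMetricSpace X] (n : ℕ) (r δ : ℝ) :
    Set ((Fin n → X × X) × (Fin n → X × X) × (Fin n → X × X) × (Fin n → X × X)) :=
  {ω | (relabel (firstNear r (coverPoints ω.1)) ω.2.1,
    relabel (firstNear r (coverPoints ω.1)) ω.2.2.1,
    relabel (firstNear r (coverPoints ω.1)) ω.2.2.2) ∈ rejectSet (Fin (n + 1)) n δ}

variable [MeasurableSpace X] (p q : Measure X) [IsProbabilityMeasure p] [IsProbabilityMeasure q]

lemma measurePreserving_relabel {ι : Type*} [MeasurableSpace ι] {φ : X → ι} (hφ : Measurable φ) :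
    MeasurePreserving (relabel φ) (pairLaw p q n) (pairLaw (p.map φ) (q.map φ) n) := by
  have := Measure.isProbabilityMeasure_map (μ := p) hφ.aemeasurable
  have := Measure.isProbabilityMeasure_map (μ := q) hφ.aemeasurable
  exact measurePreserving_pi _ _ fun _ => (hφ.measurePreserving p).prod (hφ.measurePreserving q)

lemma measureReal_relabel_preimage {ι : Type*} [MeasurableSpace ι] {φ : X → ι}
    (hφ : Measurable φ) {A : Set ((Fin n → ι × ι) × (Fin n → ι × ι) × (Fin n → ι × ι))}
    (hA : MeasurableSet A) :
    ((pairLaw p q n).prod ((pairLaw p q n).prod (pairLaw p q n))).real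
        (Prod.map (relabel φ) (Prod.map (relabel φ) (relabel φ)) ⁻¹' A) =
      ((pairLaw (p.map φ) (q.map φ) n).prod ((pairLaw (p.map φ) (q.map φ) n).prod
        (pairLaw (p.map φ) (q.map φ) n))).real A := by
  have := Measure.isProbabilityMeasure_map (μ := p) hφ.aemeasurable
  have := Measure.isProbabilityMeasure_map (μ := q) hφ.aemeasurable
  have h := measurePreserving_relabel p q (n := n) hφ
  exact (h.prod (h.prod h)).measureReal_preimage hA.nullMeasurableSet

lemma measurePreserving_coverPoints :
    MeasurePreserving coverPoints (pairLaw p q n) (Measure.pi fun _ => p) :=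
  measurePreserving_pi _ _ fun _ => measurePreserving_fst

variable [PseudoMetricSpace X] [OpensMeasurableSpace X] [SecondCountableTopology X]

lemma measurable_relabel_firstNear (r : ℝ) :
    Measurable fun a : (Fin n → X × X) × (Fin n → X × X) =>
      relabel (firstNear r (coverPoints a.1)) a.2 := by
  have hcenters : Measurable fun a : (Fin n → X × X) × (Fin n → X × X) => coverPoints a.1 :=
    measurable_pi_lambda _ fun s => ((measurable_pi_apply s).comp measurable_fst).fst
  have hpoint (s : Fin n) : Measurable fun a : (Fin n → X × X) × (Fin n → X × X) => a.2 s :=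
    (measurable_pi_apply s).comp measurable_snd
  exact measurable_pi_lambda _ fun s =>
    ((measurable_firstNear r).comp (hcenters.prodMk (hpoint s).fst)).prodMk
      ((measurable_firstNear r).comp (hcenters.prodMk (hpoint s).snd))

lemma measurableSet_coverRejectSet (n : ℕ) (r δ : ℝ) :
    MeasurableSet (coverRejectSet X n r δ) := by
  have h := measurable_relabel_firstNear (X := X) (n := n) r
  have hlabels : Measurable fun ω : (Fin n → X × X) × (Fin n → X × X) × (Fin n → X × X) ×
      (Fin n → X × X) => (relabel (firstNear r (coverPoints ω.1)) ω.2.1,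
        relabel (firstNear r (coverPoints ω.1)) ω.2.2.1,
        relabel (firstNear r (coverPoints ω.1)) ω.2.2.2) :=
    (h.comp (measurable_fst.prodMk measurable_snd.fst)).prodMk
      ((h.comp (measurable_fst.prodMk measurable_snd.snd.fst)).prodMk
        (h.comp (measurable_fst.prodMk measurable_snd.snd.snd)))
  exact hlabels (Set.toFinite _).measurableSet

/-- The tester that covers the space by balls of radius `r` around sample points and tests
closeness of the induced distributions on the cells. -/
def coverTester (X : Type*) [PseudoMetricSpace X] [MeasurableSpace X] [OpensMeasurableSpace X]
    [SecondCountableTopology X] (n : ℕ) (r δ : ℝ) : SampleTester X :=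
  rejectTester (measurable_quarterBlocks n (measurableSet_coverRejectSet n r δ))

lemma measureReal_coverRejectSet_le (r : ℝ) {δ : ℝ} (hδ : 0 < δ) (hn : 10 ^ 8 ≤ n * δ ^ 4) :
    ((pairLaw p p n).prod ((pairLaw p p n).prod ((pairLaw p p n).prod (pairLaw p p n)))).real
      (coverRejectSet X n r δ) ≤ 1 / 3 := by
  refine (measureReal_prod_le_add (t := ∅) (a := 0) (b := 2 / 9)
    (measurableSet_coverRejectSet n r δ) (by norm_num) (by simp) fun ω _ => ?_).trans (by norm_num)
  have hφ : Measurable (firstNear r (coverPoints ω)) :=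
    (measurable_firstNear r).comp measurable_prodMk_left
  have := Measure.isProbabilityMeasure_map (μ := p) hφ.aemeasurable
  exact (measureReal_relabel_preimage p p hφ (Set.toFinite _).measurableSet).trans_le
    (measureReal_rejectSet_le hδ hn)

variable {p q}

lemma le_sum_abs_of_lt_EMD {Q : Set X} (hp : p Qᶜ = 0) (hq : q Qᶜ = 0) {M ε : ℝ} (hM : 0 < M)
    (hε : 0 < ε) (hQ : ∀ x ∈ Q, ∀ y ∈ Q, dist x y ≤ M) (hfar : ENNReal.ofReal ε < EMD p q)
    (z : Fin n → X) (hz : p.real (firstNear (ε / 4) z ⁻¹' {Fin.last n}) ≤ ε / (4 * M)) :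
    ε / (2 * M) ≤ ∑ i, |(p.map (firstNear (ε / 4) z)).real {i} -
      (q.map (firstNear (ε / 4) z)).real {i}| := by
  have hlt := (ENNReal.ofReal_lt_ofReal_iff_of_nonneg hε.le).1
    (hfar.trans_le (EMD_le_of_firstNear hp hq hM.le (r := ε / 4) (by positivity) hQ z))
  rw [le_div_iff₀ (by positivity)] at hz
  rw [div_le_iff₀ (by positivity)]
  linarith

lemma measureReal_coverRejectSet_compl_le {Q : Set X} (hp : p Qᶜ = 0) (hq : q Qᶜ = 0) {M ε : ℝ}
    (hM : 0 < M) (hε : 0 < ε) (hQ : ∀ x ∈ Q, ∀ y ∈ Q, dist x y ≤ M) {k : ℕ}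
    {K : Fin k → Set X} (hK : p (⋃ i, K i)ᶜ = 0)
    (hdiam : ∀ i, ∀ x ∈ K i, ∀ y ∈ K i, dist x y ≤ ε / 4) (hfar : ENNReal.ofReal ε < EMD p q)
    (hnk : 36 * (k * (M / ε)) ≤ n) (hn : 10 ^ 8 ≤ n * (ε / (2 * M)) ^ 4) :
    ((pairLaw p q n).prod ((pairLaw p q n).prod ((pairLaw p q n).prod (pairLaw p q n)))).real
      (coverRejectSet X n (ε / 4) (ε / (2 * M)))ᶜ ≤ 1 / 3 := by
  have hn0 : 0 < n := pos_of_le_mul_pow_four hn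
  refine (measureReal_prod_le_add (a := 1 / 9) (b := 2 / 9)
    (measurableSet_coverRejectSet n _ _).compl (t := coverPoints ⁻¹'
      {z | ε / (4 * M) ≤ p.real (firstNear (ε / 4) z ⁻¹' {Fin.last n})})
    (by norm_num) ?_ fun ω hω => ?_).trans (by norm_num)
  · have hmeas : MeasurableSet {z : Fin n → X |
        ε / (4 * M) ≤ p.real (firstNear (ε / 4) z ⁻¹' {Fin.last n})} :=
      measurableSet_le measurable_const (measurable_uncovered p _).ennreal_toReal
    rw [(measurePreserving_coverPoints p q).measureReal_preimage hmeas.nullMeasurableSet]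
    refine (measureReal_uncovered_ge_le p hK hdiam hn0 (by positivity)).trans ?_
    rw [div_div, div_le_div_iff₀ (by positivity) (by norm_num)]
    field_simp at hnk ⊢
    linarith
  · have hφ : Measurable (firstNear (ε / 4) (coverPoints ω)) :=
      (measurable_firstNear _).comp measurable_prodMk_left
    have := Measure.isProbabilityMeasure_map (μ := p) hφ.aemeasurable
    have := Measure.isProbabilityMeasure_map (μ := q) hφ.aemeasurable
    exact (measureReal_relabel_preimage p q hφ (Set.toFinite _).measurableSet).trans_le
      (measureReal_rejectSet_compl_le (by positivity) hn (by simp)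
        (le_sum_abs_of_lt_EMD hp hq hM hε hQ hfar _ (not_le.1 hω).le))

theorem coverTester_isEMDClosenessTester {Q : Set X} {k : ℕ} {M ε : ℝ} (hM : 0 < M) (hε : 0 < ε)
    (hQ : ∀ x ∈ Q, ∀ y ∈ Q, dist x y ≤ M) (hnk : 36 * (k * (M / ε)) ≤ n)
    (hn : 10 ^ 8 ≤ n * (ε / (2 * M)) ^ 4) :
    (coverTester X n (ε / 4) (ε / (2 * M))).IsEMDClosenessTester ε
      (clusterablePairsIn Q k (ε / 4)) := by
  have hmeas := measurableSet_coverRejectSet (X := X) n (ε / 4) (ε / (2 * M))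
  refine rejectTester_isEMDClosenessTester _ (fun p q h => ⟨h.1, h.2.1⟩) ?_ ?_
  · rintro p ⟨hp, -⟩
    rw [(measurePreserving_quarterBlocks (p.prod p) n).measureReal_preimage
      hmeas.nullMeasurableSet]
    exact measureReal_coverRejectSet_le p _ (by positivity) hn
  · rintro p q ⟨hp, hq, hpQ, hqQ, K, hK, -, hdiam⟩ hfar
    have hpK : p (⋃ i, K i)ᶜ = 0 := by
      rw [hK]
      exact measure_mono_null (Set.compl_subset_compl.2 Set.subset_union_left)
        Measure.measure_compl_support
    rw [← Set.preimage_compl, (measurePreserving_quarterBlocks (p.prod q) n).measureReal_preimage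
      hmeas.compl.nullMeasurableSet]
    exact measureReal_coverRejectSet_compl_le hpQ hqQ hM hε hQ hpK hdiam hfar hnk hn

end CoverTester

section SampleComplexity

lemma add_rpow_mul_pow_four_le (k : ℕ) {D : ℝ} (hD : 1 ≤ D) :
    k * D + (k : ℝ) ^ (2 / 3 : ℝ) * D ^ 4 ≤ 2 * (k * D ^ 4) := by
  have hk : (k : ℝ) ^ (2 / 3 : ℝ) ≤ k := by
    rcases Nat.eq_zero_or_pos k with rfl | hk
    · simp
    · exact Real.rpow_le_self_of_one_le (by exact_mod_cast hk) (by norm_num)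
  have hlinear : k * D ≤ k * D ^ 4 := by gcongr; exact le_self_pow₀ hD four_ne_zero
  have hquartic : (k : ℝ) ^ (2 / 3 : ℝ) * D ^ 4 ≤ k * D ^ 4 := by gcongr
  linarith

variable {X : Type*} [MeasurableSpace X] [PseudoMetricSpace X] [OpensMeasurableSpace X]
  [SecondCountableTopology X]

lemma exists_isEMDClosenessTester_of_le {Q : Set X} {k : ℕ} (hk : k ≠ 0) {M ε : ℝ}
    (hε : 0 < ε) (hεM : ε ≤ M) (hQ : ∀ x ∈ Q, ∀ y ∈ Q, dist x y ≤ M) :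
    ∃ T : SampleTester X, T.IsEMDClosenessTester ε (clusterablePairsIn Q k (ε / 4)) ∧
      (T.samples : ℝ) ≤
        2 * 10 ^ 10 * (k * (M / ε) + (k : ℝ) ^ (2 / 3 : ℝ) * (M / ε) ^ 4) := by
  have hM : 0 < M := hε.trans_le hεM
  have hk1 : (1 : ℝ) ≤ k := by exact_mod_cast Nat.one_le_iff_ne_zero.2 hk
  set D := M / ε with hDdef
  have hD : 1 ≤ D := (one_le_div hε).2 hεM
  have hkD : 1 ≤ k * D := one_le_mul_of_one_le_of_one_le hk1 hD
  have hkD4 : D ^ 4 ≤ (k : ℝ) ^ (2 / 3 : ℝ) * D ^ 4 :=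
    le_mul_of_one_le_left (by positivity) (Real.one_le_rpow hk1 (by norm_num))
  set n := ⌈36 * (k * D) + 16 * 10 ^ 8 * D ^ 4⌉₊
  have hle : 36 * (k * D) + 16 * 10 ^ 8 * D ^ 4 ≤ n := Nat.le_ceil _
  have hlt : (n : ℝ) < 36 * (k * D) + 16 * 10 ^ 8 * D ^ 4 + 1 :=
    Nat.ceil_lt_add_one (by positivity)
  have hn : 10 ^ 8 ≤ n * (ε / (2 * M)) ^ 4 := by
    have hδ : ε / (2 * M) = (2 * D)⁻¹ := by rw [hDdef]; field_simp
    rw [hδ, inv_pow, ← div_eq_mul_inv, le_div_iff₀ (by positivity), mul_pow]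
    linarith
  refine ⟨coverTester X n (ε / 4) (ε / (2 * M)), coverTester_isEMDClosenessTester hM hε hQ
    (by linarith [pow_nonneg (zero_le_one.trans hD) 4]) hn, ?_⟩
  simp only [SampleTester.samples, coverTester, rejectTester]
  push_cast
  linarith

end SampleComplexity

lemma dist_le_of_mem_cube {d : ℕ} {Δ : ℝ} {x y : L1Space d} (hx : x ∈ cube d Δ)
    (hy : y ∈ cube d Δ) : dist x y ≤ d * Δ := by
  rw [PiLp.dist_eq_of_L1]
  calc ∑ i, dist (x i) (y i) ≤ ∑ _i : Fin d, Δ := Finset.sum_le_sum fun i _ => by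
        simpa using Real.dist_le_of_mem_Icc (hx i) (hy i)
    _ = d * Δ := by simp

end EMDTesting

end

open EMDTesting in
theorem theorem19_general {X : Type*} [MeasurableSpace X] [PseudoMetricSpace X]
    [OpensMeasurableSpace X] [SecondCountableTopology X] {Q : Set X} {M ε : ℝ} (k : ℕ)
    (hM : 0 ≤ M) (hε : 0 < ε) (hQ : ∀ x ∈ Q, ∀ y ∈ Q, dist x y ≤ M) :
    (∃ T : SampleTester X, T.IsEMDClosenessTester ε (clusterablePairsIn Q k (ε / 4)) ∧
      (T.samples : ℝ) ≤ softBound (2 * 10 ^ 10) 0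
        (k * (M / ε) + (k : ℝ) ^ (2 / 3 : ℝ) * (M / ε) ^ 4) ∧
      (T.samples : ℝ) ≤ softBound (4 * 10 ^ 10) 0 (k * (M / ε) ^ 4)) ∧
    (ε ≤ M → softBound (2 * 10 ^ 10) 0
        (k * (M / ε) + (k : ℝ) ^ (2 / 3 : ℝ) * (M / ε) ^ 4) ≤
      softBound (4 * 10 ^ 10) 0 (k * (M / ε) ^ 4)) := by
  simp only [softBound, pow_zero, mul_one]
  have hcompare (h : ε ≤ M) :
      2 * 10 ^ 10 * (k * (M / ε) + (k : ℝ) ^ (2 / 3 : ℝ) * (M / ε) ^ 4) ≤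
        4 * 10 ^ 10 * (k * (M / ε) ^ 4) := by
    linarith [add_rpow_mul_pow_four_le k ((one_le_div hε).2 h)]
  refine ⟨?_, hcompare⟩
  by_cases htrivial : k = 0 ∨ M ≤ ε
  · refine ⟨_, rejectTester_empty_isEMDClosenessTester hQ htrivial, ?_, ?_⟩ <;>
    · simp only [SampleTester.samples, rejectTester, mul_zero, Nat.cast_zero]
      positivity
  · obtain ⟨hk, hεM⟩ := not_or.1 htrivial
    have hεM := (not_le.1 hεM).le
    obtain ⟨T, hT, hsamples⟩ := exists_isEMDClosenessTester_of_le hk hε hεM hQ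
    exact ⟨T, hT, hsamples, hsamples.trans (hcompare hεM)⟩

theorem theorem19 :
    ∃ (C : ℝ) (c : ℕ) (C' : ℝ) (c' : ℕ),
      ∀ (d : ℕ) (Δ ε : ℝ) (k : ℕ), 0 < Δ → 0 < ε →
        (∃ T : EMDTesting.SampleTester (EMDTesting.L1Space d),
          T.IsEMDClosenessTester ε (EMDTesting.clusterablePairs d Δ k (ε / 4)) ∧
          (T.samples : ℝ) ≤ EMDTesting.softBound C c
            (k * (d * Δ / ε) + (k : ℝ) ^ (2 / 3 : ℝ) * (d * Δ / ε) ^ 4) ∧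
          (T.samples : ℝ) ≤ EMDTesting.softBound C' c' (k * (d * Δ / ε) ^ 4)) ∧
        (ε ≤ d * Δ →
          EMDTesting.softBound C c
              (k * (d * Δ / ε) + (k : ℝ) ^ (2 / 3 : ℝ) * (d * Δ / ε) ^ 4) ≤
            EMDTesting.softBound C' c' (k * (d * Δ / ε) ^ 4)) :=
  ⟨2 * 10 ^ 10, 0, 4 * 10 ^ 10, 0, fun _ _ _ k hΔ hε => theorem19_general k (by positivity) hε
    fun _ hx _ hy => EMDTesting.dist_le_of_mem_cube hx hy⟩
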